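/- Let $R$ be a commutative absolutely flat (von Neumann regular) ring, i.e. for every $r\in R$ there is $x\in R$ with $r=r^2x$. Suppose that $R$ is not semi-artinian, i.e. it is not the case that every nonzero quotient $R$-module of $R$ contains a simple submodule. For $\mathfrak p\in\operatorname{Spec}R$ let $k(\mathfrak p)$ be the residue field, viewed as a complex in degree $0$ in the unbounded derived category $D(R)$, and let $\langle k(\mathfrak p)\mid \mathfrak p\in\operatorname{Spec}R\rangle$ be the smallest localising subcategory (full triangulated subcategory closed under isomorphisms and set-indexed coproducts) of $D(R)$ containing all the $k(\mathfrak p)$. Then $$\langle k(\mathfrak p)\mid \mathfrak p\in\operatorname{Spec}R\rangle\subsetneq D(R).$$ More precisely, there is a nonzero injective $R$-module $E$ that is superdecomposable (it has no nonzero indecomposable direct summand) and right orthogonal to every residue field, i.e. $\operatorname{Hom}_{D(R)}(k(\mathfrak p),\Sigma^iE)=0$ for all $\mathfrak p\in\operatorname{Spec}R$ and all $i\in\mathbb Z$; this $E$, as a complex in degree $0$, does not lie in $\langle k(\mathfrak p)\mid \mathfrak p\in\operatorname{Spec}R\rangle$. -/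

import Mathlib

open CategoryTheory

universe w v u

namespace ResidueGeneration

/-- A commutative ring is absolutely flat (von Neumann regular) if every `r` can be written
`r = r ^ 2 * x`. -/
def IsAbsolutelyFlat (R : Type u) [CommRing R] : Prop :=
  ∀ r : R, ∃ x : R, r = r ^ 2 * x

/-- A commutative ring `R` is semi-artinian if every nonzero homomorphic image of the `R`-module
`R` (that is, every nonzero quotient `R ⧸ I`) contains a simple submodule. -/
def IsSemiartinian (R : Type u) [CommRing R] : Prop :=
  ∀ I : Ideal R, Nontrivial (R ⧸ I) → ∃ N : Submodule R (R ⧸ I), IsSimpleModule R N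

/-- A module is indecomposable if it is nonzero and is not the internal direct sum of two nonzero
submodules. -/
def IsIndecomposable (R : Type u) [CommRing R] (M : Type v) [AddCommGroup M] [Module R M] :
    Prop :=
  Nontrivial M ∧ ∀ A B : Submodule R M, IsCompl A B → A = ⊥ ∨ B = ⊥

/-- A module is superdecomposable if it has no (nonzero) indecomposable direct summand. The zero
module satisfies this. -/
def IsSuperdecomposable (R : Type u) [CommRing R] (M : Type v) [AddCommGroup M] [Module R M] :
    Prop :=
  ∀ A B : Submodule R M, IsCompl A B → ¬ IsIndecomposable R A

section Triangulated

variable {C : Type*} [Category* C] [Limits.HasZeroObject C] [HasShift C ℤ] [Preadditive C]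
  [∀ n : ℤ, (shiftFunctor C n).Additive] [Pretriangulated C]

/-- A localising subcategory: a strictly full triangulated subcategory closed under
all coproducts indexed by types in `Type w`. -/
structure IsLocalising (P : ObjectProperty C) : Prop where
  isTriangulated : P.IsTriangulated
  isClosedUnderIsomorphisms : P.IsClosedUnderIsomorphisms
  coproducts : ∀ J : Type w, P.IsClosedUnderColimitsOfShape (Discrete J)

/-- The localising subcategory generated by the objects satisfying `P`: the intersection of all
localising subcategories containing them. -/
def localisingClosure (P : ObjectProperty C) : ObjectProperty C :=
  fun X => ∀ Q : ObjectProperty C, IsLocalising.{w} Q → P ≤ Q → Q X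

end Triangulated

section Derived

variable (R : Type u) [CommRing R] [HasDerivedCategory.{w} (ModuleCat.{u} R)]

/-- An `R`-module, as an object of `D(R)` concentrated in degree `0`. -/
noncomputable def moduleInDerived (M : ModuleCat.{u} R) : DerivedCategory (ModuleCat.{u} R) :=
  (DerivedCategory.singleFunctor (ModuleCat.{u} R) 0).obj M

/-- The residue field `k(p)` as an object of `D(R)`. -/
noncomputable def residueFieldInDerived (p : PrimeSpectrum R) :
    DerivedCategory (ModuleCat.{u} R) :=
  moduleInDerived R (ModuleCat.of R p.asIdeal.ResidueField)

/-- The localising subcategory `⟨k(p) | p ∈ Spec R⟩` of `D(R)`. -/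
noncomputable def residueFieldsLocalising :
    ObjectProperty (DerivedCategory (ModuleCat.{u} R)) :=
  localisingClosure.{u} (fun X => ∃ p : PrimeSpectrum R, X = residueFieldInDerived R p)

end Derived

end ResidueGeneration

namespace ResidueGeneration

section Essential

variable {R : Type u} [CommRing R]

/-! Failure of semi-artinianness gives a nonzero cyclic module R/I with empty socle; take `E` to be
its injective hull. A simple submodule of `E` would meet R/I, so `E` has no simple submodule either
(`not_isSimpleModule_of_essential`). Over an absolutely flat ring indecomposables are simple, so `E`
is superdecomposable; each k(p) is simple, so Hom(k(p), E) = 0, and injectivity of `E` extends this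
to all shifts (`singleFunctor_hom_shift_eq_zero`). The objects with no maps to shifts of `E` form a
localising subcategory containing every k(p) but not `E`, since the identity of `E` is nonzero. -/

/-- Every element of `N` has a multiple that is a nonzero element of `S`, unless it is zero. -/
def IsEssentialIn {J : Type v} [AddCommGroup J] [Module R J] (S N : Submodule R J) : Prop :=
  ∀ x ∈ N, x ≠ 0 → ∃ r : R, r • x ∈ S ∧ r • x ≠ 0

lemma exists_maximal_isEssentialIn {J : Type v} [AddCommGroup J] [Module R J]
    (S : Submodule R J) :
    ∃ N, S ≤ N ∧ Maximal (fun N => IsEssentialIn S N) N := by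
  refine zorn_le_nonempty₀ {N | IsEssentialIn S N} (fun c hc hchain y hy => ?_) S
    (fun x hx h0 => ⟨1, by simpa using hx, by simpa using h0⟩)
  refine ⟨sSup c, fun x hx h0 => ?_, fun z hz => le_sSup hz⟩
  obtain ⟨N, hN, hxN⟩ := (Submodule.mem_sSup_of_directed ⟨y, hy⟩ hchain.directedOn).1 hx
  exact hc hN x hxN h0

lemma exists_maximal_disjoint {J : Type v} [AddCommGroup J] [Module R J]
    (N : Submodule R J) : ∃ K, Maximal (fun K => Disjoint N K) K := by
  obtain ⟨K, -, hK⟩ := zorn_le_nonempty₀ {K | Disjoint N K} (fun c hc hchain y hy =>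
    ⟨sSup c, (hchain.directedOn.disjoint_sSup_right).2 fun z hz => hc hz,
      fun z hz => le_sSup hz⟩) ⊥ disjoint_bot_right
  exact ⟨K, hK⟩

/-- In an injective module a maximal essential extension of a submodule is a direct summand. -/
lemma exists_isCompl_of_maximal_isEssentialIn {J : Type v} [AddCommGroup J] [Module R J]
    [Module.Injective R J] {S N : Submodule R J}
    (hN : Maximal (fun N => IsEssentialIn S N) N) : ∃ K, IsCompl N K := by
  obtain ⟨K, hK⟩ := exists_maximal_disjoint N
  have hNK : ∀ x ∈ N, x ∈ K → x = 0 := fun x h₁ h₂ =>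
    Submodule.disjoint_def.1 hK.prop x h₁ h₂
  -- Maximality of `K` makes `N` essential in `J ⧸ K`.
  have key : ∀ y : J ⧸ K, y ≠ 0 → ∃ r : R, ∃ n ∈ N, n ≠ 0 ∧ r • y = K.mkQ n := by
    intro y hy
    obtain ⟨x, rfl⟩ := K.mkQ_surjective y
    have hx : x ∉ K := fun h => hy (by simpa using h)
    have hnd : ¬ Disjoint N (K ⊔ Submodule.span R {x}) := fun h =>
      hx (hK.le_of_ge h le_sup_left
        (Submodule.mem_sup_right (Submodule.mem_span_singleton_self x)))
    rw [Submodule.disjoint_def] at hnd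
    push Not at hnd
    obtain ⟨n, hnN, hn, hn0⟩ := hnd
    obtain ⟨k, hk, z, hz, rfl⟩ := Submodule.mem_sup.1 hn
    obtain ⟨r, rfl⟩ := Submodule.mem_span_singleton.1 hz
    refine ⟨r, _, hnN, hn0, ?_⟩
    have : K.mkQ k = 0 := by simpa using hk
    rw [map_add, this, zero_add, map_smul]
  obtain ⟨g, hg⟩ := Module.Injective.out (R := R) (Q := J) (K.mkQ ∘ₗ N.subtype)
    (by
      rw [← LinearMap.ker_eq_bot, LinearMap.ker_eq_bot']
      intro n hn
      exact Subtype.ext (hNK n n.2 (by simpa using hn)))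
    N.subtype
  have hg' : ∀ n ∈ N, g (K.mkQ n) = n := fun n hn => hg ⟨n, hn⟩
  -- The image of `g` is essential over `S` and contains `N`, so maximality of `N` forces equality.
  have hrange : ∀ y, g y ∈ N := by
    have hess : IsEssentialIn S (LinearMap.range g) := by
      rintro _ ⟨y, rfl⟩ h0
      obtain ⟨r, n, hn, hn0, hrn⟩ := key y (fun h => h0 (by rw [h, map_zero]))
      obtain ⟨s, hs, hs0⟩ := hN.prop n hn hn0
      have : (s * r) • g y = s • n := by rw [mul_smul, ← map_smul g r, hrn, hg' n hn]
      exact ⟨s * r, this ▸ hs, this ▸ hs0⟩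
    exact fun y => hN.le_of_ge hess (fun n hn => ⟨_, hg' n hn⟩) ⟨y, rfl⟩
  have hinj : ∀ y, g y = 0 → y = 0 := by
    intro y hy
    by_contra h0
    obtain ⟨r, n, hn, hn0, hrn⟩ := key y h0
    apply hn0
    rw [← hg' n hn, ← hrn, map_smul, hy, smul_zero]
  refine ⟨K, hK.prop, codisjoint_iff.2 (eq_top_iff.2 fun x _ => ?_)⟩
  refine Submodule.mem_sup.2 ⟨g (K.mkQ x), hrange _, x - g (K.mkQ x), ?_, by abel⟩
  have : K.mkQ (x - g (K.mkQ x)) = 0 := hinj _ (by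
    rw [map_sub, map_sub, hg' _ (hrange _), sub_self])
  exact (Submodule.Quotient.mk_eq_zero K).1 this

lemma injective_of_isCompl {J : Type v} [AddCommGroup J] [Module R J]
    [Module.Injective R J] {N K : Submodule R J} (h : IsCompl N K) : Module.Injective R N where
  out X Y _ _ _ _ f hf g := by
    obtain ⟨l, hl⟩ := Module.Injective.out (R := R) (Q := J) f hf (N.subtype ∘ₗ g)
    exact ⟨N.projectionOnto K h ∘ₗ l, fun x => by simp [hl]⟩

/-- Existence of injective hulls. -/
theorem exists_injective_hull (M : ModuleCat.{u} R) :
    ∃ (E : ModuleCat.{u} R) (f : M →ₗ[R] E), Module.Injective R E ∧ Function.Injective f ∧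
      ∀ x : E, x ≠ 0 → ∃ (r : R) (m : M), f m = r • x ∧ m ≠ 0 := by
  let J := Injective.under M
  have hι : Function.Injective (Injective.ι M).hom :=
    (ModuleCat.mono_iff_injective _).1 inferInstance
  have : Injective (ModuleCat.of R J) := inferInstanceAs (Injective (Injective.under M))
  have : Module.Injective R J := Module.injective_module_of_injective_object R J
  obtain ⟨N, hSN, hN⟩ := exists_maximal_isEssentialIn (LinearMap.range (Injective.ι M).hom)
  obtain ⟨K, hK⟩ := exists_isCompl_of_maximal_isEssentialIn hN
  refine ⟨ModuleCat.of R N, (Injective.ι M).hom.codRestrict N fun m => hSN ⟨m, rfl⟩,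
    injective_of_isCompl hK, fun a b hab => hι (congrArg Subtype.val hab), fun x hx => ?_⟩
  obtain ⟨r, ⟨m, hm⟩, h0⟩ := hN.prop x.1 x.2 (fun h => hx (Subtype.ext h))
  refine ⟨r, m, Subtype.ext hm, ?_⟩
  rintro rfl
  exact h0 (by rw [← hm, map_zero])

/-- An essential extension of a module without simple submodules has no simple submodules. -/
lemma not_isSimpleModule_of_essential {M : Type v} {E : Type w} [AddCommGroup M] [Module R M]
    [AddCommGroup E] [Module R E] (f : M →ₗ[R] E) (hf : Function.Injective f)
    (hess : ∀ x : E, x ≠ 0 → ∃ (r : R) (m : M), f m = r • x ∧ m ≠ 0)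
    (hM : ∀ N : Submodule R M, ¬ IsSimpleModule R N) (T : Submodule R E) :
    ¬ IsSimpleModule R T := by
  intro hT
  obtain ⟨t, ht, ht0⟩ := T.ne_bot_iff.1 ((isSimpleModule_iff_isAtom.1 hT).1)
  obtain ⟨r, m, hm, hm0⟩ := hess t ht0
  have hmap : (T.comap f).map f = T := by
    refine ((isSimpleModule_iff_isAtom.1 hT).le_iff.1 (Submodule.map_comap_le f T)).resolve_left ?_
    exact (Submodule.ne_bot_iff _).2
      ⟨f m, Submodule.mem_map_of_mem (by simpa [hm] using T.smul_mem r ht),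
        (map_ne_zero_iff f hf).2 hm0⟩
  refine hM (T.comap f) ?_
  have e := (Submodule.equivMapOfInjective f hf (T.comap f)).trans (LinearEquiv.ofEq _ _ hmap)
  exact IsSimpleModule.congr e

end Essential

/-! ### Modules over absolutely flat rings -/

section AbsolutelyFlat

variable {R : Type u} [CommRing R]

lemma IsAbsolutelyFlat.isMaximal (hflat : IsAbsolutelyFlat R) (p : Ideal R) [hp : p.IsPrime] :
    p.IsMaximal := by
  refine Ideal.isMaximal_iff.2 ⟨fun h => hp.ne_top ((Ideal.eq_top_iff_one _).2 h), ?_⟩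
  intro J r hpJ hr hrJ
  obtain ⟨x, hx⟩ := hflat r
  have h1 : 1 - r * x ∈ p := (hp.mem_or_mem (x := r) (y := 1 - r * x)
    (by rw [show r * (1 - r * x) = 0 by linear_combination hx]; exact p.zero_mem)).resolve_left hr
  have := J.add_mem (hpJ h1) (J.mul_mem_right x hrJ)
  simpa using this

/-- Over an absolutely flat ring each scalar acts on an indecomposable module either as zero or
invertibly. -/
lemma IsIndecomposable.smul_eq_zero_or_exists_inverse (hflat : IsAbsolutelyFlat R) {M : Type v}
    [AddCommGroup M] [Module R M] (hM : IsIndecomposable R M) (r : R) :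
    (∀ m : M, r • m = 0) ∨ ∃ x : R, ∀ m : M, x • r • m = m := by
  obtain ⟨x, hx⟩ := hflat r
  -- The idempotent `r * x` generates the same ideal as `r` and splits `M`.
  have he : (r * x) * (r * x) = r * x := by linear_combination (-x) * hx
  let φ : M →ₗ[R] M := LinearMap.lsmul R M (r * x)
  have hφ : ∀ m, φ m = (r * x) • m := fun m => rfl
  have hcompl : IsCompl (LinearMap.range φ) (LinearMap.ker φ) := by
    constructor
    · rw [Submodule.disjoint_def]
      rintro _ ⟨m, rfl⟩ h
      rwa [LinearMap.mem_ker, hφ, hφ, ← mul_smul, he] at h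
    · refine codisjoint_iff.2 (eq_top_iff.2 fun m _ => Submodule.mem_sup.2
        ⟨φ m, ⟨m, rfl⟩, m - φ m, ?_, by abel⟩)
      rw [LinearMap.mem_ker, map_sub, hφ, hφ, ← mul_smul, he, sub_self]
  rcases hM.2 _ _ hcompl with h | h
  · left
    intro m
    have hm : (r * x) • m = 0 := by
      have : φ m ∈ LinearMap.range φ := ⟨m, rfl⟩
      rwa [h, Submodule.mem_bot] at this
    rw [show r = r * (r * x) by linear_combination hx, mul_smul, hm, smul_zero]
  · right
    refine ⟨x, fun m => ?_⟩
    have : m - φ m ∈ LinearMap.ker φ := by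
      rw [LinearMap.mem_ker, map_sub, hφ, hφ, ← mul_smul, he, sub_self]
    rw [h, Submodule.mem_bot, sub_eq_zero, hφ] at this
    rw [← mul_smul, mul_comm x r, ← this]

/-- Indecomposable modules over an absolutely flat ring are simple. -/
lemma IsIndecomposable.isSimpleModule (hflat : IsAbsolutelyFlat R) {M : Type v}
    [AddCommGroup M] [Module R M] (hM : IsIndecomposable R M) : IsSimpleModule R M := by
  have hinv := hM.smul_eq_zero_or_exists_inverse hflat
  have hatom : ∀ x : M, x ≠ 0 → IsAtom (Submodule.span R {x}) := by
    refine fun x hx => ⟨by simpa using hx, fun B hB => ?_⟩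
    by_contra hB0
    obtain ⟨b, hb, hb0⟩ := B.ne_bot_iff.1 hB0
    obtain ⟨r, rfl⟩ := Submodule.mem_span_singleton.1 (hB.le hb)
    rcases hinv r with h | ⟨y, hy⟩
    · exact hb0 (h x)
    · exact hB.not_ge ((Submodule.span_singleton_le_iff_mem _ _).2 (hy x ▸ B.smul_mem y hb))
  have hss : IsSemisimpleModule R M := by
    refine sSup_simples_eq_top_iff_isSemisimpleModule.1 (eq_top_iff.2 fun x _ => ?_)
    by_cases hx : x = 0
    · exact hx ▸ Submodule.zero_mem _
    · exact le_sSup (a := Submodule.span R {x}) (isSimpleModule_iff_isAtom.2 (hatom x hx))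
        (Submodule.mem_span_singleton_self x)
  have := hM.1
  rw [isSimpleModule_iff_toSpanSingleton_surjective]
  refine ⟨hM.1, fun x hx => ?_⟩
  obtain ⟨B, hB⟩ := exists_isCompl (Submodule.span R {x})
  rw [← LinearMap.range_eq_top, LinearMap.range_toSpanSingleton]
  rcases hM.2 _ _ hB with h | rfl
  · exact absurd h (hatom x hx).1
  · simpa using hB.sup_eq_top

lemma isSuperdecomposable_of_no_simple (hflat : IsAbsolutelyFlat R) {M : Type v}
    [AddCommGroup M] [Module R M] (hM : ∀ N : Submodule R M, ¬ IsSimpleModule R N) :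
    IsSuperdecomposable R M :=
  fun A _ _ hA => hM A (hA.isSimpleModule hflat)

lemma IsAbsolutelyFlat.isSimpleModule_residueField (hflat : IsAbsolutelyFlat R)
    (p : Ideal R) [p.IsPrime] : IsSimpleModule R p.ResidueField := by
  have := hflat.isMaximal p
  rw [isSimpleModule_iff_toSpanSingleton_surjective]
  refine ⟨inferInstance, fun x hx y => ?_⟩
  obtain ⟨r, hr⟩ := p.algebraMap_residueField_surjective (y / x)
  exact ⟨r, by rw [LinearMap.toSpanSingleton_apply, Algebra.smul_def, hr, div_mul_cancel₀ y hx]⟩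

lemma linearMap_eq_zero_of_no_simple {S : Type v} {M : Type w} [AddCommGroup S] [Module R S]
    [AddCommGroup M] [Module R M] [IsSimpleModule R S]
    (hM : ∀ N : Submodule R M, ¬ IsSimpleModule R N) (f : S →ₗ[R] M) : f = 0 := by
  rcases f.injective_or_eq_zero with h | h
  · exact (hM (LinearMap.range f)
      (IsSimpleModule.congr (LinearEquiv.ofInjective f h).symm)).elim
  · exact h

end AbsolutelyFlat

/-! ### Left orthogonals as localising subcategories -/

section LeftOrthogonal

/-- The objects isomorphic to a shift of `Y`. -/
def shiftsOf {C : Type*} [Category* C] [HasShift C ℤ] (Y : C) : ObjectProperty C :=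
  fun Z => ∃ i : ℤ, Nonempty (Z ≅ Y⟦i⟧)

instance {C : Type*} [Category* C] [HasShift C ℤ] (Y : C) : (shiftsOf Y).IsStableUnderShift ℤ where
  isStableUnderShiftBy n := ⟨fun _ ⟨i, ⟨e⟩⟩ =>
    ⟨i + n, ⟨(shiftFunctor C n).mapIso e ≪≫ (shiftFunctorAdd C i n).symm.app Y⟩⟩⟩

lemma leftOrthogonal_shiftsOf_iff {C : Type*} [Category* C] [HasShift C ℤ] [Preadditive C]
    (X Y : C) :
    (shiftsOf Y).leftOrthogonal X ↔ ∀ (i : ℤ) (f : X ⟶ Y⟦i⟧), f = 0 := by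
  refine ⟨fun h i f => h f ⟨i, ⟨Iso.refl _⟩⟩, fun h Z f ⟨i, ⟨e⟩⟩ => ?_⟩
  rw [← cancel_mono e.hom, Limits.zero_comp]
  exact h i _

variable {C : Type*} [Category* C] [Limits.HasZeroObject C] [HasShift C ℤ] [Preadditive C]
  [∀ n : ℤ, (shiftFunctor C n).Additive] [Pretriangulated C]

/-- Shift stability of `P` makes the orthogonal triangulated; coproducts are harmless because a map
out of one is determined by its components. -/
lemma isLocalising_leftOrthogonal (P : ObjectProperty C) [P.IsStableUnderShift ℤ] :
    IsLocalising.{w} P.leftOrthogonal where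
  isTriangulated := inferInstance
  isClosedUnderIsomorphisms := inferInstance
  coproducts J := ⟨fun X ⟨hX⟩ Y f hY => hX.isColimit.hom_ext fun j => by
    rw [Limits.comp_zero]
    exact hX.prop_diag_obj j _ hY⟩

end LeftOrthogonal

/-! ### Maps into shifts of an injective object -/

section Derived

variable {A : Type u} [Category.{v} A] [Abelian A] [HasDerivedCategory.{w} A]

open DerivedCategory in
/-- Morphisms from an object to the shifts of an injective object in the derived category vanish
as soon as they vanish in the abelian category. -/
lemma singleFunctor_hom_shift_eq_zero {X I : A} [Injective I] (h : ∀ f : X ⟶ I, f = 0) (i : ℤ)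
    (f : (singleFunctor A 0).obj X ⟶ ((singleFunctor A 0).obj I)⟦i⟧) : f = 0 := by
  -- Negative shifts vanish by the t-structure, degree zero by fullness of the embedding, positive
  -- shifts because they are Ext groups into an injective.
  rcases lt_trichotomy i 0 with hi | rfl | hi
  · have := TStructure.t.isGE_shift ((singleFunctor A 0).obj I) 0 i (-i)
    exact TStructure.t.zero f 0 (-i)
  · rw [← cancel_mono ((shiftFunctorZero (DerivedCategory A) ℤ).hom.app _), Limits.zero_comp]
    obtain ⟨g, hg⟩ := (singleFunctor A 0).map_surjective
      (f ≫ (shiftFunctorZero (DerivedCategory A) ℤ).hom.app ((singleFunctor A 0).obj I))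
    rw [← hg, h g, Functor.map_zero]
  · obtain ⟨n, rfl⟩ : ∃ n : ℕ, i = ((n + 1 : ℕ) : ℤ) := ⟨(i - 1).toNat, by lia⟩
    have := hasExt_of_hasDerivedCategory A
    obtain ⟨e, rfl⟩ := (Abelian.Ext.homEquiv (X := X) (Y := I) (n := n + 1)).surjective f
    rw [e.eq_zero_of_injective]
    exact Abelian.Ext.zero_hom ..

end Derived

end ResidueGeneration

open ResidueGeneration

theorem mainTheorem3 (R : Type u) [CommRing R] [HasDerivedCategory.{w} (ModuleCat.{u} R)]
    (hflat : ResidueGeneration.IsAbsolutelyFlat R)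
    (hart : ¬ ResidueGeneration.IsSemiartinian R) :
    ResidueGeneration.residueFieldsLocalising R < ⊤ ∧
      ∃ E : ModuleCat.{u} R,
        Nontrivial E ∧ Module.Injective R E ∧ ResidueGeneration.IsSuperdecomposable R E ∧
        (∀ (p : PrimeSpectrum R) (i : ℤ)
          (f : ResidueGeneration.residueFieldInDerived R p ⟶
            (shiftFunctor (DerivedCategory (ModuleCat.{u} R)) i).obj
              (ResidueGeneration.moduleInDerived R E)), f = 0) ∧
        ¬ ResidueGeneration.residueFieldsLocalising R
            (ResidueGeneration.moduleInDerived R E) := by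
  obtain ⟨I, hI, hsimple⟩ : ∃ I : Ideal R, Nontrivial (R ⧸ I) ∧
      ∀ N : Submodule R (R ⧸ I), ¬ IsSimpleModule R N := by
    simpa [IsSemiartinian] using hart
  obtain ⟨E, f, hE, hf, hess⟩ := exists_injective_hull (ModuleCat.of R (R ⧸ I))
  have hno := not_isSimpleModule_of_essential f hf hess hsimple
  have hnt : Nontrivial E := hf.nontrivial
  have hEinj : Injective E := Module.injective_object_of_injective_module R E
  have horth : ∀ (p : PrimeSpectrum R) (i : ℤ)
      (f : residueFieldInDerived R p ⟶ (moduleInDerived R E)⟦i⟧), f = 0 := by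
    intro p i f
    refine singleFunctor_hom_shift_eq_zero (fun g => ?_) i f
    have := hflat.isSimpleModule_residueField p.asIdeal
    exact ModuleCat.hom_ext (linearMap_eq_zero_of_no_simple hno g.hom)
  have hnot : ¬ residueFieldsLocalising R (moduleInDerived R E) := by
    intro h
    -- Were `E` in the closure, it would be orthogonal to itself.
    have hleft : (shiftsOf (moduleInDerived R E)).leftOrthogonal (moduleInDerived R E) := by
      refine h _ (isLocalising_leftOrthogonal _) ?_
      rintro _ ⟨p, rfl⟩
      exact (leftOrthogonal_shiftsOf_iff _ _).2 (horth p)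
    have hid : 𝟙 (moduleInDerived R E) = 0 :=
      hleft _ ⟨0, ⟨((shiftFunctorZero _ ℤ).app _).symm⟩⟩
    have hidE : 𝟙 E = 0 := (DerivedCategory.singleFunctor (ModuleCat.{u} R) 0).map_injective (by
      rw [CategoryTheory.Functor.map_id, Functor.map_zero]
      exact hid)
    obtain ⟨x, hx⟩ := exists_ne (0 : E)
    exact hx (by simpa using congrArg (fun φ : E ⟶ E => φ.hom x) hidE)
  exact ⟨lt_top_iff_ne_top.2 fun h => hnot (h ▸ trivial), E, hnt, hE,
    isSuperdecomposable_of_no_simple hflat hno, horth, hnot⟩
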